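/- For an odd integer $m\ge 2$ and an integer $n$ let the Euler quotient $Q_m(n)$ be the integer with $0\le Q_m(n)<m$ and $Q_m(n)\equiv \frac{n^{\phi(m)}-1}{m} \pmod m$ if $\gcd(n,m)=1$, and $Q_m(n)=0$ if $\gcd(n,m)>1$, where $\phi$ is Euler's totient function. There is an absolute constant $C$ such that the following holds. Let $m\ge 2$ be odd, let $k>3$ be an integer with $k\mid m$, and suppose that the function $n\mapsto Q_m(n)$ on the integers is $km$-periodic, $k$ being the least positive integer for which this holds (for instance, $km$ may be the least positive period of $Q_m$). Let $s$ be the $km$-periodic binary sequence with $s_t=0$ if $0\le \frac{Q_m(t)}{m}<\frac12$ and $s_t=1$ if $\frac12\le\frac{Q_m(t)}{m}<1$. Then $$\left|\sum_{t=0}^{km-1}(-1)^{s_t+s_{t+m}+s_{t+2m}+s_{t+3m}}-\left(km-\frac23 k\phi(m)\right)\right|\le C\,\phi(m)\,\phi(k)^{-1}k^{3/2}(\log m)^4 .$$ -/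

import Mathlib

/-- The Euler quotient `Q_m(n)`: the residue in `[0, m)` of `(n ^ φ(m) - 1) / m` modulo `m` when
`n` is coprime to `m` (the division by `m` is then exact, by Euler's theorem), and `0` when
`gcd(n, m) > 1`. -/
def eulerQuotient (m : ℕ) (n : ℤ) : ℤ :=
  if Int.gcd n m = 1 then ((n ^ Nat.totient m - 1) / (m : ℤ)) % (m : ℤ) else 0

/-- `Q_m` is `km`-periodic, and `k` is not too large for this: `k` is the least positive integer
such that `k * m` is a period of `Q_m` on the integers. This holds in particular if `k * m` is
the least positive period of `Q_m`. -/
def IsPeriodMultiplier (m k : ℕ) : Prop :=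
  IsLeast {j : ℕ | 0 < j ∧ Function.Periodic (eulerQuotient m) ((j : ℤ) * (m : ℤ))} k

/-- The binary sequence with `s_t = 0` if `0 ≤ Q_m(t) / m < 1 / 2` and `s_t = 1` otherwise. -/
def eulerBit (m : ℕ) (t : ℤ) : ℕ :=
  if 0 ≤ (eulerQuotient m t : ℚ) / (m : ℚ) ∧ (eulerQuotient m t : ℚ) / (m : ℚ) < 1 / 2
  then 0 else 1

/-! The proof is elementary and uses no character sums. The sign attached to `t` is a square wave of
`2 * Q_m(t)`. If `t` is prime to `m`, the binomial expansion makes `Q_m(t + m * l)` linear in `l`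
modulo `m`, with slope `φ(m) / t` (`eulerQuotient_add_mul`). Minimality of `k` gives `m = d * k` and
`φ(m) = d * u` with `u` prime to `k` (`IsPeriodMultiplier.exists_factor`). After division by `d`,
the sum over `l < k` is therefore a complete four-point correlation of the wave modulo `k` with
shift `b = 2 * u / t`, an explicit piecewise linear function of `b` (`sum_waveProd`).

As `t` runs over the units modulo `m`, `b` takes each unit modulo `k` equally often. Möbius
inversion shows that the correlation has mean close to `k / 3` over these units, with total error
`O(k)` per divisor of `k`, and there are at most `2 * √k` divisors. The units thus contribute about
`k * φ(m) / 3`, and the other `t`, all of sign one, exactly `k * (m - φ(m))`. -/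

/-! ### Square waves and their products over progressions. -/

/-- The square wave `(-1) ^ ⌊i / k⌋` on the integers. -/
noncomputable def squareWave (k : ℕ) (i : ℤ) : ℝ := (-1) ^ (i / (k : ℤ))

theorem squareWave_add_self {k : ℕ} (hk : k ≠ 0) (i : ℤ) :
    squareWave k (i + k) = -squareWave k i := by
  have : (k : ℤ) ≠ 0 := by exact_mod_cast hk
  rw [squareWave, Int.add_ediv_of_dvd_right dvd_rfl, Int.ediv_self this,
    zpow_add₀ (by norm_num), squareWave]
  simp

theorem squareWave_add_mul {k : ℕ} (hk : k ≠ 0) (i q : ℤ) :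
    squareWave k (i + q * k) = (-1) ^ q * squareWave k i := by
  have : (k : ℤ) ≠ 0 := by exact_mod_cast hk
  rw [squareWave, Int.add_mul_ediv_right _ _ this, zpow_add₀ (by norm_num), squareWave, mul_comm]

theorem squareWave_mul_left (d k : ℕ) (i : ℤ) :
    squareWave (d * k) i = squareWave k (i / d) := by
  rw [squareWave, squareWave, Int.ediv_ediv_of_nonneg (by positivity), Nat.cast_mul]

theorem squareWave_eq_one {k : ℕ} {i : ℤ} (h₀ : 0 ≤ i) (h₁ : i < k) : squareWave k i = 1 := by
  rw [squareWave, Int.ediv_eq_zero_of_lt h₀ h₁, zpow_zero]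

theorem squareWave_eq_neg_one {k : ℕ} {i : ℤ} (h₀ : (k : ℤ) ≤ i) (h₁ : i < 2 * k) :
    squareWave k i = -1 := by
  have hk : k ≠ 0 := by omega
  have := squareWave_add_self hk (i - k)
  rw [sub_add_cancel, squareWave_eq_one (i := i - k) (by omega) (by omega)] at this
  linarith

/-- The product of the square wave over a four-term progression. -/
noncomputable def waveProd (k : ℕ) (b i : ℤ) : ℝ :=
  squareWave k i * squareWave k (i + b) * squareWave k (i + 2 * b) * squareWave k (i + 3 * b)

theorem neg_one_zpow_sq (q : ℤ) : ((-1 : ℝ) ^ q) ^ 2 = 1 := by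
  rcases Int.even_or_odd q with h | h
  · simp [h.neg_one_zpow]
  · simp [h.neg_one_zpow]

/-- The wave only changes sign under a shift by `k`; the four sign changes cancel. -/
theorem waveProd_periodic {k : ℕ} (hk : k ≠ 0) (b : ℤ) :
    Function.Periodic (waveProd k b) (k : ℤ) := by
  intro i
  simp only [waveProd, add_right_comm i (k : ℤ), squareWave_add_self hk]
  ring

/-- The factors change by `(-1)` to the powers `0`, `q`, `2 * q`, `3 * q`, whose sum `6 * q` is
even. Hence only `b` modulo `k` matters. -/
theorem waveProd_add_mul {k : ℕ} (hk : k ≠ 0) (b q i : ℤ) :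
    waveProd k (b + q * k) i = waveProd k b i := by
  have h1 : i + (b + q * k) = (i + b) + q * k := by ring
  have h2 : i + 2 * (b + q * k) = (i + 2 * b) + (2 * q) * k := by ring
  have h3 : i + 3 * (b + q * k) = (i + 3 * b) + (3 * q) * k := by ring
  have e2 : ((-1 : ℝ) ^ (2 * q)) = 1 := by rw [mul_comm, zpow_mul]; exact_mod_cast neg_one_zpow_sq q
  have e3 : ((-1 : ℝ) ^ (3 * q)) = (-1) ^ q := by
    rw [show 3 * q = 2 * q + q by ring, zpow_add₀ (by norm_num), e2, one_mul]
  rw [waveProd, h1, h2, h3, squareWave_add_mul hk, squareWave_add_mul hk, squareWave_add_mul hk,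
    e2, e3, waveProd]
  linear_combination (squareWave k i * squareWave k (i + b) * squareWave k (i + 2 * b) *
    squareWave k (i + 3 * b)) * neg_one_zpow_sq q

theorem waveProd_emod {k : ℕ} (hk : k ≠ 0) (b i : ℤ) :
    waveProd k (b % k) i = waveProd k b i := by
  conv_rhs => rw [← Int.emod_add_mul_ediv b k, mul_comm (k : ℤ), waveProd_add_mul hk]

theorem Function.Periodic.sum_range_affine {k : ℕ} (hk : k ≠ 0) {f : ℤ → ℝ}
    (hf : Function.Periodic f (k : ℤ)) (w : ℤ) {a : ℤ} (ha : IsCoprime a k) :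
    ∑ l ∈ Finset.range k, f (w + a * l) = ∑ i ∈ Finset.range k, f i := by
  have : NeZero k := ⟨hk⟩
  have key : ∀ i : ℤ, f i = f (((i : ZMod k)).val : ℤ) := fun i => by
    rw [ZMod.val_intCast, Int.emod_def, mul_comm, ← smul_eq_mul, hf.sub_zsmul_eq]
  have tr : ∀ g : ZMod k → ℝ, ∑ l ∈ Finset.range k, g (l : ZMod k) = ∑ x, g x := fun g => by
    refine Finset.sum_bij' (fun l _ => (l : ZMod k)) (fun x _ => x.val) ?_ ?_ ?_ ?_ ?_
    · simp
    · intro x _; simpa using x.val_lt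
    · intro l hl; exact ZMod.val_cast_of_lt (by simpa using hl)
    · intro x _; simp
    · simp
  have h1 := tr (fun x => f ((((w : ZMod k) + a * x).val : ℕ) : ℤ))
  have h2 := tr (fun x => f (((x).val : ℕ) : ℤ))
  have e1 : ∀ l : ℕ, f (w + a * l) = f ((((w : ZMod k) + a * (l : ZMod k)).val : ℕ) : ℤ) :=
    fun l => by rw [key]; push_cast; rfl
  have e2 : ∀ l : ℕ, f l = f ((((l : ZMod k)).val : ℕ) : ℤ) := fun l => by rw [key]; push_cast; rfl
  simp only [e1]
  rw [Finset.sum_congr rfl fun i _ => e2 i, h1, h2]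
  have hu : IsUnit (a : ZMod k) := (ZMod.coe_int_isUnit_iff_isCoprime a k).2 ha.symm
  obtain ⟨u, hu⟩ := hu
  rw [← hu]
  exact Equiv.sum_comp ((Units.mulLeft u).trans (Equiv.addLeft (w : ZMod k)))
    (fun x => f ((x.val : ℕ) : ℤ))

/-! ### Evaluation of the four-point correlation. -/

/-- The correlation `∑ i < k, waveProd k b i` for `0 ≤ b < k`, as a function of a real
variable. -/
noncomputable def waveCorr (k x : ℝ) : ℝ :=
  k - 4 * x + 12 * max (x - k / 3) 0 - 16 * max (x - k / 2) 0 + 12 * max (x - 2 * k / 3) 0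

theorem squareWave_mul_add {k b : ℕ} (hb : b < k) (i : ℤ) :
    squareWave k i * squareWave k (i + b) = if (k : ℤ) - b ≤ i % k then -1 else 1 := by
  have hk : k ≠ 0 := by omega
  have hk' : (k : ℤ) ≠ 0 := by exact_mod_cast hk
  have h0 := Int.emod_nonneg i hk'
  have h1 := Int.emod_lt_of_pos i (by omega : (0 : ℤ) < k)
  conv_lhs => rw [← Int.emod_add_mul_ediv i k, mul_comm (k : ℤ), add_right_comm,
    squareWave_add_mul hk, squareWave_add_mul hk]
  have e := neg_one_zpow_sq (i / k)
  rw [squareWave_eq_one h0 h1]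
  split_ifs with h
  · rw [squareWave_eq_neg_one (by omega) (by omega)]; linear_combination -e
  · rw [squareWave_eq_one (by omega) (by omega)]; linear_combination e

theorem card_arc_inter {k b : ℕ} (hb : b < k) :
    (((Finset.range k).filter fun i : ℕ =>
      (k : ℤ) - b ≤ (i : ℤ) % k ∧ (k : ℤ) - b ≤ ((i : ℤ) + 2 * b) % k).card : ℝ) =
      3 * max ((b : ℝ) - k / 3) 0 - 4 * max ((b : ℝ) - k / 2) 0 +
        3 * max ((b : ℝ) - 2 * k / 3) 0 := by
  have hset : ((Finset.range k).filter fun i : ℕ =>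
      (k : ℤ) - b ≤ (i : ℤ) % k ∧ (k : ℤ) - b ≤ ((i : ℤ) + 2 * b) % k) =
      Finset.Ico (max (k - b) (2 * k - 3 * b)) (min k (2 * k - 2 * b)) ∪
        Finset.Ico (3 * k - 3 * b) k := by
    ext i
    simp only [Finset.mem_filter, Finset.mem_range, Finset.mem_union, Finset.mem_Ico]
    by_cases hi : i < k
    swap
    · omega
    rw [Int.emod_eq_of_lt (a := (i : ℤ)) (by omega) (by omega)]
    by_cases hib : k - b ≤ i
    swap
    · omega
    -- Since `k - b ≤ i < k`, the point `i + 2 * b` wraps around once or twice; each case gives one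
    -- of the two intervals.
    by_cases h2 : i + 2 * b < 2 * k
    · rw [← Int.sub_emod_right, Int.emod_eq_of_lt (by omega) (by omega)]
      omega
    · rw [← Int.sub_emod_right, ← Int.sub_emod_right, Int.emod_eq_of_lt (by omega) (by omega)]
      omega
  have hd : Disjoint (Finset.Ico (max (k - b) (2 * k - 3 * b)) (min k (2 * k - 2 * b)))
      (Finset.Ico (3 * k - 3 * b) k) := by
    rw [Finset.disjoint_left]
    intro i
    simp only [Finset.mem_Ico]
    omega
  rw [hset, Finset.card_union_of_disjoint hd, Nat.card_Ico, Nat.card_Ico]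
  have hbR : (b : ℝ) < k := by exact_mod_cast hb
  have hb0 : (0 : ℝ) ≤ b := b.cast_nonneg
  -- The breakpoints `k / 3`, `k / 2`, `2 * k / 3` are where an interval changes its shape or
  -- becomes nonempty. Truncated subtraction counts empty intervals as zero.
  rcases le_or_gt (3 * b) k with h1 | h1
  · have h1' : 3 * (b : ℝ) ≤ k := by exact_mod_cast h1
    rw [max_eq_right (a := (b : ℝ) - k / 3) (by linarith),
      max_eq_right (a := (b : ℝ) - k / 2) (by linarith),
      max_eq_right (a := (b : ℝ) - 2 * k / 3) (by linarith),
      show min k (2 * k - 2 * b) - max (k - b) (2 * k - 3 * b) + (k - (3 * k - 3 * b)) = 0 by omega]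
    simp
  have h1' : (k : ℝ) < 3 * b := by exact_mod_cast h1
  rcases le_or_gt (2 * b) k with h2 | h2
  · have h2' : 2 * (b : ℝ) ≤ k := by exact_mod_cast h2
    rw [max_eq_left (a := (b : ℝ) - k / 3) (by linarith),
      max_eq_right (a := (b : ℝ) - k / 2) (by linarith),
      max_eq_right (a := (b : ℝ) - 2 * k / 3) (by linarith),
      show min k (2 * k - 2 * b) - max (k - b) (2 * k - 3 * b) + (k - (3 * k - 3 * b)) =
        3 * b - k by omega, Nat.cast_sub (by omega)]
    push_cast
    ring
  have h2' : (k : ℝ) < 2 * b := by exact_mod_cast h2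
  rcases le_or_gt (3 * b) (2 * k) with h3 | h3
  · have h3' : 3 * (b : ℝ) ≤ 2 * k := by exact_mod_cast h3
    rw [max_eq_left (a := (b : ℝ) - k / 3) (by linarith),
      max_eq_left (a := (b : ℝ) - k / 2) (by linarith),
      max_eq_right (a := (b : ℝ) - 2 * k / 3) (by linarith),
      show min k (2 * k - 2 * b) - max (k - b) (2 * k - 3 * b) + (k - (3 * k - 3 * b)) =
        k - b by omega, Nat.cast_sub (by omega)]
    ring
  · have h3' : 2 * (k : ℝ) < 3 * b := by exact_mod_cast h3
    rw [max_eq_left (a := (b : ℝ) - k / 3) (by linarith),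
      max_eq_left (a := (b : ℝ) - k / 2) (by linarith),
      max_eq_left (a := (b : ℝ) - 2 * k / 3) (by linarith),
      show min k (2 * k - 2 * b) - max (k - b) (2 * k - 3 * b) + (k - (3 * k - 3 * b)) =
        2 * b - k by omega, Nat.cast_sub (by omega)]
    push_cast
    ring

theorem card_arc {k b : ℕ} (hb : b < k) :
    ((Finset.range k).filter fun i : ℕ => (k : ℤ) - b ≤ (i : ℤ) % k).card = b := by
  have hset : ((Finset.range k).filter fun i : ℕ => (k : ℤ) - b ≤ (i : ℤ) % k) =
      Finset.Ico (k - b) k := by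
    ext i
    simp only [Finset.mem_filter, Finset.mem_range, Finset.mem_Ico]
    by_cases hi : i < k
    · rw [Int.emod_eq_of_lt (a := (i : ℤ)) (by omega) (by omega)]
      omega
    · omega
  rw [hset, Nat.card_Ico]
  omega

theorem sum_waveProd {k b : ℕ} (hb : b < k) :
    ∑ i ∈ Finset.range k, waveProd k b i = waveCorr k b := by
  have hk : k ≠ 0 := by omega
  set A : ℤ → ℝ := fun i => if (k : ℤ) - b ≤ i % k then 1 else 0 with hA
  -- The first two factors multiply to `1 - 2 * A i`, the last two to `1 - 2 * A (i + 2 * b)`, so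
  -- the sum reduces to the size of an arc and of its intersection with a translate.
  have hprod : ∀ i : ℤ, waveProd k b i =
      1 - 2 * A i - 2 * A (2 * b + 1 * i) + 4 * (A i * A (2 * b + 1 * i)) := by
    intro i
    have a := squareWave_mul_add hb i
    have c := squareWave_mul_add hb (i + 2 * b)
    rw [show i + 2 * b + b = i + 3 * b by ring] at c
    rw [waveProd, a, mul_assoc, c, one_mul, add_comm (2 * (b : ℤ)) i]
    simp only [hA]
    split_ifs <;> norm_num
  have hper : Function.Periodic A (k : ℤ) := fun i => by simp [hA]
  have h1 : ∑ i ∈ Finset.range k, A i = b := by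
    simp only [hA]
    rw [Finset.sum_boole, card_arc hb]
  have h2 : ∑ i ∈ Finset.range k, A (2 * b + 1 * i) = b := by
    rw [hper.sum_range_affine hk _ isCoprime_one_left, h1]
  have h3 : ∑ i ∈ Finset.range k, A i * A (2 * b + 1 * i) =
      3 * max ((b : ℝ) - k / 3) 0 - 4 * max ((b : ℝ) - k / 2) 0 +
        3 * max ((b : ℝ) - 2 * k / 3) 0 := by
    rw [← card_arc_inter hb, ← Finset.sum_boole]
    refine Finset.sum_congr rfl fun i _ => ?_
    simp only [hA, one_mul, add_comm (2 * (b : ℤ)), ite_and]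
    split_ifs <;> simp
  simp only [hprod, Finset.sum_add_distrib, Finset.sum_sub_distrib, ← Finset.mul_sum, h1, h2, h3,
    waveCorr]
  simp
  ring

/-! ### Mean of the correlation over all shifts. -/

theorem sq_max_increment (x : ℝ) :
    |max (x + 1) 0 ^ 2 - max x 0 ^ 2 - 2 * max x 0| ≤ 1 := by
  rw [abs_le]
  rcases le_total 0 x with h | h
  · rw [max_eq_left h, max_eq_left (by linarith)]
    constructor <;> nlinarith
  · rw [max_eq_right h]
    rcases le_total 0 (x + 1) with h' | h'
    · rw [max_eq_left h']
      constructor <;> nlinarith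
    · rw [max_eq_right h']
      norm_num

/-- A primitive of `waveCorr k`. -/
noncomputable def waveCorrPrimitive (k x : ℝ) : ℝ :=
  k * x - 2 * x ^ 2 + 6 * max (x - k / 3) 0 ^ 2 - 8 * max (x - k / 2) 0 ^ 2 +
    6 * max (x - 2 * k / 3) 0 ^ 2

theorem abs_waveCorr_sub_le (k x : ℝ) :
    |waveCorr k x - (waveCorrPrimitive k (x + 1) - waveCorrPrimitive k x)| ≤ 22 := by
  have h1 := abs_le.1 (sq_max_increment (x - k / 3))
  have h2 := abs_le.1 (sq_max_increment (x - k / 2))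
  have h3 := abs_le.1 (sq_max_increment (x - 2 * k / 3))
  rw [sub_add_eq_add_sub] at h1 h2 h3
  rw [abs_le, waveCorr, waveCorrPrimitive, waveCorrPrimitive]
  -- The constant is `22 = 2 + 6 + 8 + 6`, the sum of the absolute coefficients of the squares in
  -- the primitive.
  constructor <;> nlinarith

theorem abs_sum_waveCorr_sub_le (N : ℕ) :
    |∑ e ∈ Finset.range N, waveCorr N (e : ℝ) - (N : ℝ) ^ 2 / 3| ≤ 22 * (N : ℝ) := by
  have h0 : (0 : ℝ) ≤ N := N.cast_nonneg
  have hN : (N : ℝ) ^ 2 / 3 = ∑ e ∈ Finset.range N,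
      (waveCorrPrimitive N ((e : ℝ) + 1) - waveCorrPrimitive N e) := by
    have := Finset.sum_range_sub (fun e : ℕ => waveCorrPrimitive N e) N
    push_cast at this
    rw [this, waveCorrPrimitive, waveCorrPrimitive, max_eq_left (by linarith),
      max_eq_left (by linarith), max_eq_left (by linarith), max_eq_right (by linarith),
      max_eq_right (by linarith), max_eq_right (by linarith)]
    ring
  rw [hN, ← Finset.sum_sub_distrib]
  refine (Finset.abs_sum_le_sum_abs _ _).trans
    ((Finset.sum_le_card_nsmul _ _ 22 fun e _ => abs_waveCorr_sub_le N (e : ℕ)).trans_eq ?_)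
  simp [mul_comm]

/-- Homogeneity turns a sum over the multiples of `d` below `k` into a sum over all shifts for the
modulus `k / d`. -/
theorem waveCorr_mul {c : ℝ} (hc : 0 ≤ c) (k x : ℝ) :
    waveCorr (c * k) (c * x) = c * waveCorr k x := by
  have e (y : ℝ) : max (c * y) 0 = c * max y 0 := by rw [mul_max_of_nonneg _ _ hc, mul_zero]
  rw [waveCorr, waveCorr, ← mul_div_assoc' c k 3, ← mul_div_assoc' c k 2,
    show 2 * (c * k) / 3 = c * (2 * k / 3) by ring, ← mul_sub, ← mul_sub, ← mul_sub, e, e, e]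
  ring

/-! ### Mean over the shifts prime to `k`. -/

theorem Nat.card_divisors_le_two_mul_sqrt (n : ℕ) : n.divisors.card ≤ 2 * n.sqrt := by
  have hsub : n.divisors ⊆ Finset.Icc 1 n.sqrt ∪ (Finset.Icc 1 n.sqrt).image (n / ·) := by
    intro d hd
    have hdn := Nat.dvd_of_mem_divisors hd
    have hn := (Nat.mem_divisors.1 hd).2
    obtain ⟨e, rfl⟩ := hdn
    have hd0 : 0 < d := Nat.pos_of_ne_zero (left_ne_zero_of_mul hn)
    have he0 : 0 < e := Nat.pos_of_ne_zero (right_ne_zero_of_mul hn)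
    simp only [Finset.mem_union, Finset.mem_Icc, Finset.mem_image, Nat.le_sqrt]
    rcases le_total d e with h | h
    · exact .inl ⟨hd0, Nat.mul_le_mul_left _ h⟩
    · exact .inr ⟨e, ⟨he0, Nat.mul_le_mul_right _ h⟩, Nat.mul_div_cancel _ he0⟩
  refine (Finset.card_le_card hsub).trans ((Finset.card_union_le _ _).trans ?_)
  have := Finset.card_image_le (s := Finset.Icc 1 n.sqrt) (f := (n / ·))
  simp only [Nat.card_Icc, Nat.add_sub_cancel] at *
  omega

theorem sum_range_coprime {k : ℕ} (hk : k ≠ 0) (g : ℕ → ℝ) :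
    ∑ b ∈ (Finset.range k).filter (Nat.Coprime · k), g b =
      ∑ d ∈ k.divisors, (ArithmeticFunction.moebius d : ℝ) *
        ∑ e ∈ Finset.range (k / d), g (d * e) := by
  have hind : ∀ b : ℕ, (if b.Coprime k then g b else 0) =
      ∑ d ∈ k.divisors, if d ∣ b then (ArithmeticFunction.moebius d : ℝ) * g b else 0 := by
    intro b
    have h := congrArg (fun F : ArithmeticFunction ℤ => F (Nat.gcd b k))
      ArithmeticFunction.moebius_mul_coe_zeta
    simp only [ArithmeticFunction.coe_mul_zeta_apply, ArithmeticFunction.one_apply] at h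
    rw [← Finset.sum_filter, ← Finset.sum_mul]
    have hf : k.divisors.filter (· ∣ b) = (Nat.gcd b k).divisors := by
      ext d
      simp [Nat.dvd_gcd_iff, hk]
      tauto
    rw [hf, ← Int.cast_sum, h]
    by_cases hc : Nat.gcd b k = 1 <;> simp [Nat.Coprime, hc]
  rw [Finset.sum_filter, Finset.sum_congr rfl fun b _ => hind b, Finset.sum_comm]
  refine Finset.sum_congr rfl fun d hd => ?_
  obtain ⟨c, rfl⟩ := Nat.dvd_of_mem_divisors hd
  have hd0 : 0 < d := Nat.pos_of_ne_zero (left_ne_zero_of_mul hk)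
  rw [Nat.mul_div_cancel_left _ hd0, Finset.mul_sum, ← Finset.sum_filter]
  symm
  refine Finset.sum_bij (fun e _ => d * e) ?_ ?_ ?_ ?_
  · intro e he
    simp only [Finset.mem_filter, Finset.mem_range] at *
    exact ⟨Nat.mul_lt_mul_of_pos_left he hd0, dvd_mul_right _ _⟩
  · intro e _ e' _ h
    exact Nat.eq_of_mul_eq_mul_left hd0 h
  · intro b hb
    simp only [Finset.mem_filter, Finset.mem_range] at hb
    obtain ⟨hb, e, rfl⟩ := hb
    exact ⟨e, Finset.mem_range.2 (Nat.lt_of_mul_lt_mul_left hb), rfl⟩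
  · intros
    rfl

theorem abs_sum_coprime_waveCorr_sub_le {k : ℕ} (hk : k ≠ 0) :
    |∑ b ∈ (Finset.range k).filter (Nat.Coprime · k), waveCorr k b -
      (k : ℝ) * Nat.totient k / 3| ≤ 22 * (k : ℝ) * k.divisors.card := by
  have htot : (Nat.totient k : ℝ) =
      ∑ d ∈ k.divisors, (ArithmeticFunction.moebius d : ℝ) * (k / d : ℕ) := by
    have := sum_range_coprime hk fun _ => 1
    simp only [Finset.sum_const, Finset.card_range, nsmul_eq_mul, mul_one] at this
    rw [← this, Nat.totient_eq_card_coprime]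
    simp only [Nat.coprime_comm]
  rw [sum_range_coprime hk, htot, Finset.mul_sum, Finset.sum_div, ← Finset.sum_sub_distrib]
  refine (Finset.abs_sum_le_sum_abs _ _).trans
    ((Finset.sum_le_card_nsmul _ _ (22 * (k : ℝ)) ?_).trans_eq (by rw [nsmul_eq_mul, mul_comm]))
  intro d hd
  obtain ⟨c, rfl⟩ := Nat.dvd_of_mem_divisors hd
  have hd0 : 0 < d := Nat.pos_of_ne_zero (left_ne_zero_of_mul hk)
  rw [Nat.mul_div_cancel_left _ hd0]
  have h := abs_sum_waveCorr_sub_le c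
  have hmu : |(ArithmeticFunction.moebius d : ℝ)| ≤ 1 := by
    exact_mod_cast ArithmeticFunction.abs_moebius_le_one (n := d)
  have e : (ArithmeticFunction.moebius d : ℝ) *
      ∑ e ∈ Finset.range c, waveCorr ((d * c : ℕ) : ℝ) ((d * e : ℕ) : ℝ) -
      ((d * c : ℕ) : ℝ) * ((ArithmeticFunction.moebius d : ℝ) * c) / 3 =
      ArithmeticFunction.moebius d * (d *
        (∑ e ∈ Finset.range c, waveCorr c e - (c : ℝ) ^ 2 / 3)) := by
    push_cast
    simp only [waveCorr_mul d.cast_nonneg, ← Finset.mul_sum]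
    ring
  rw [e, abs_mul, abs_mul, Nat.abs_cast]
  push_cast
  -- The scaling factor `d` and the length `c = k / d` multiply to `k`, so every divisor costs the
  -- same.
  calc _ ≤ 1 * ((d : ℝ) * (22 * c)) := by gcongr
    _ = _ := by ring

/-! ### Euler quotients along progressions of difference `m`. -/

theorem isCoprime_of_mul_modEq_one {m t t' : ℤ} (h : t * t' ≡ 1 [ZMOD m]) : IsCoprime t m := by
  obtain ⟨c, hc⟩ := h.dvd
  exact ⟨t', c, by linear_combination -hc⟩

theorem Int.dvd_pow_totient_sub_one {m : ℕ} {t : ℤ} (h : IsCoprime t m) :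
    (m : ℤ) ∣ t ^ Nat.totient m - 1 := by
  rw [← ZMod.intCast_zmod_eq_zero_iff_dvd]
  have := congrArg (Units.val) (ZMod.pow_totient (ZMod.unitOfIsCoprime t h))
  push_cast at this
  rw [ZMod.coe_unitOfIsCoprime] at this
  simp [this]

theorem eulerQuotient_modEq {m : ℕ} (hm : m ≠ 0) {t : ℤ} (h : IsCoprime t m) {a : ℤ}
    (ha : t ^ Nat.totient m - 1 = m * a) : eulerQuotient m t ≡ a [ZMOD m] := by
  rw [eulerQuotient, if_pos (Int.isCoprime_iff_gcd_eq_one.1 h), ha,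
    Int.mul_ediv_cancel_left _ (by exact_mod_cast hm)]
  exact Int.mod_modEq a m

theorem eulerQuotient_add_mul {m : ℕ} (hm : m ≠ 0) {t t' : ℤ} (h : t * t' ≡ 1 [ZMOD m]) (l : ℤ) :
    eulerQuotient m (t + m * l) ≡ eulerQuotient m t + Nat.totient m * l * t' [ZMOD m] := by
  have hc := isCoprime_of_mul_modEq_one h
  have hc' : IsCoprime (t + m * l) m := hc.add_mul_left_left l
  obtain ⟨a, ha⟩ := Int.dvd_pow_totient_sub_one hc
  obtain ⟨z, hz⟩ := Polynomial.powAddExpansion t (m * l) (Nat.totient m)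
  have hpos : 0 < Nat.totient m := Nat.totient_pos.2 (Nat.pos_of_ne_zero hm)
  have hinv : t ^ (Nat.totient m - 1) ≡ t' [ZMOD m] := by
    have h1 : t * t ^ (Nat.totient m - 1) ≡ 1 [ZMOD m] := by
      rw [← pow_succ', Nat.sub_add_cancel hpos]
      exact (Int.modEq_iff_dvd.2 ⟨a, ha⟩).symm
    calc t ^ (Nat.totient m - 1) = 1 * t ^ (Nat.totient m - 1) := (one_mul _).symm
      _ ≡ t * t' * t ^ (Nat.totient m - 1) [ZMOD m] := h.symm.mul_right _
      _ = t * t ^ (Nat.totient m - 1) * t' := by ring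
      _ ≡ 1 * t' [ZMOD m] := h1.mul_right _
      _ = t' := one_mul _
  have hexp : (t + m * l) ^ Nat.totient m - 1 =
      m * (a + Nat.totient m * l * t ^ (Nat.totient m - 1) + m * (z * l ^ 2)) := by
    rw [hz]
    linear_combination ha
  calc eulerQuotient m (t + m * l)
      ≡ a + Nat.totient m * l * t ^ (Nat.totient m - 1) + m * (z * l ^ 2) [ZMOD m] :=
        eulerQuotient_modEq hm hc' hexp
    _ ≡ a + Nat.totient m * l * t ^ (Nat.totient m - 1) [ZMOD m] := by
        simp [Int.ModEq]
    _ ≡ eulerQuotient m t + Nat.totient m * l * t' [ZMOD m] :=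
        (eulerQuotient_modEq hm hc ha).symm.add (hinv.mul_left _)

theorem eulerQuotient_bounds {m : ℕ} (hm : m ≠ 0) (t : ℤ) :
    0 ≤ eulerQuotient m t ∧ eulerQuotient m t < m := by
  have : (0 : ℤ) < m := by exact_mod_cast Nat.pos_of_ne_zero hm
  rw [eulerQuotient]
  split_ifs
  · exact ⟨Int.emod_nonneg _ this.ne', Int.emod_lt_of_pos _ this⟩
  · exact ⟨le_rfl, this⟩

theorem eulerQuotient_eq_zero {m : ℕ} {t : ℤ} (h : ¬IsCoprime t m) : eulerQuotient m t = 0 := by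
  rw [eulerQuotient, if_neg (mt Int.isCoprime_iff_gcd_eq_one.2 h)]

theorem eulerQuotient_one (m : ℕ) : eulerQuotient m 1 = 0 := by
  simp [eulerQuotient]

theorem neg_one_pow_eulerBit {m : ℕ} (hm : m ≠ 0) (t : ℤ) :
    (-1 : ℝ) ^ eulerBit m t = squareWave m (2 * eulerQuotient m t) := by
  obtain ⟨h0, h1⟩ := eulerQuotient_bounds hm t
  have hm0 : (0 : ℚ) < m := by exact_mod_cast Nat.pos_of_ne_zero hm
  have hiff : (0 ≤ (eulerQuotient m t : ℚ) / (m : ℚ) ∧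
      (eulerQuotient m t : ℚ) / (m : ℚ) < 1 / 2) ↔ 2 * eulerQuotient m t < m := by
    rw [div_lt_div_iff₀ hm0 two_pos, one_mul, mul_comm, and_iff_right]
    · exact_mod_cast Iff.rfl
    · have : (0 : ℚ) ≤ eulerQuotient m t := by exact_mod_cast h0
      positivity
  rw [eulerBit]
  simp only [hiff]
  split_ifs with h
  · rw [squareWave_eq_one (by omega) h, pow_zero]
  · rw [squareWave_eq_neg_one (by omega) (by omega), pow_one]

theorem squareWave_two_mul_congr {m : ℕ} (hm : m ≠ 0) {a b : ℤ} (h : a ≡ b [ZMOD m]) :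
    squareWave m (2 * a) = squareWave m (2 * b) := by
  obtain ⟨c, hc⟩ := h.dvd
  rw [show 2 * b = 2 * a + (2 * c) * m by linear_combination 2 * hc, squareWave_add_mul hm,
    (even_two_mul c).neg_one_zpow, one_mul]

/-- The period multiplier `k` determines the common part of `m` and `φ(m)`. -/
theorem IsPeriodMultiplier.exists_factor {m k : ℕ} (hm : m ≠ 0) (hkm : k ∣ m)
    (h : IsPeriodMultiplier m k) :
    ∃ d u : ℕ, m = d * k ∧ Nat.totient m = d * u ∧ Nat.Coprime u k := by
  obtain ⟨⟨hk, hper⟩, hmin⟩ := h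
  obtain ⟨d, rfl⟩ := hkm
  -- Comparing the quotients at `1` and `1 + m * k` shows that `m` divides `φ(m) * k`.
  have h1 : ((k * d : ℕ) : ℤ) ∣ Nat.totient (k * d) * k := by
    have a := eulerQuotient_add_mul hm (t := 1) (t' := 1) rfl k
    have b := hper 1
    rw [mul_comm (k : ℤ)] at b
    rw [b, eulerQuotient_one] at a
    rw [zero_add, mul_one] at a
    exact Int.modEq_zero_iff_dvd.1 a.symm
  have h2 : k * d ∣ Nat.totient (k * d) * k := by exact_mod_cast h1
  rw [mul_comm _ k, Nat.mul_dvd_mul_iff_left hk] at h2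
  obtain ⟨u, hu⟩ := h2
  refine ⟨d, u, mul_comm _ _, hu, ?_⟩
  -- If `g` exceeded `1`, then `j = k / g` would be a smaller multiplier, because `m` still divides
  -- `φ(m) * j`.
  set g := Nat.gcd u k
  have hg0 : 0 < g := Nat.gcd_pos_of_pos_right _ hk
  obtain ⟨u', hu'⟩ : g ∣ u := Nat.gcd_dvd_left _ _
  obtain ⟨j, hj⟩ : g ∣ k := Nat.gcd_dvd_right _ _
  have hj0 : 0 < j := Nat.pos_of_ne_zero (by rintro rfl; simp at hj; omega)
  have hjper : Function.Periodic (eulerQuotient (k * d)) ((j : ℤ) * ((k * d : ℕ) : ℤ)) := by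
    intro t
    by_cases hc : IsCoprime t ((k * d : ℕ) : ℤ)
    · obtain ⟨t', c, htc⟩ := hc
      have ht : t * t' ≡ 1 [ZMOD ((k * d : ℕ) : ℤ)] :=
        Int.modEq_iff_dvd.2 ⟨c, by linear_combination -htc⟩
      have a := eulerQuotient_add_mul hm ht j
      have e : (Nat.totient (k * d) : ℤ) * j * t' = ((k * d : ℕ) : ℤ) * (u' * t') := by
        rw [hu, hu']
        conv_rhs => rw [hj]
        push_cast
        ring
      rw [e] at a
      have a' : eulerQuotient (k * d) (t + ((k * d : ℕ) : ℤ) * j) ≡ eulerQuotient (k * d) t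
        [ZMOD ((k * d : ℕ) : ℤ)] := a.trans (by simp [Int.ModEq])
      have b0 := eulerQuotient_bounds hm t
      have b1 := eulerQuotient_bounds hm (t + ((k * d : ℕ) : ℤ) * j)
      rw [mul_comm (j : ℤ)]
      rwa [Int.ModEq, Int.emod_eq_of_lt b1.1 b1.2, Int.emod_eq_of_lt b0.1 b0.2] at a'
    · rw [eulerQuotient_eq_zero hc, eulerQuotient_eq_zero]
      rwa [IsCoprime.add_mul_right_left_iff]
  have hle : k ≤ j := hmin ⟨hj0, hjper⟩
  have : g * j ≤ 1 * j := by omega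
  have := Nat.le_of_mul_le_mul_right this hj0
  change g = 1
  omega

/-! ### The sum over one residue class modulo `m`. -/

/-- The summand of the correlation of order four. -/
noncomputable def eulerSign (m : ℕ) (t : ℤ) : ℝ :=
  (-1 : ℝ) ^ (eulerBit m t + eulerBit m (t + (m : ℤ)) + eulerBit m (t + 2 * (m : ℤ)) +
    eulerBit m (t + 3 * (m : ℤ)))

theorem eulerSign_eq {m : ℕ} (hm : m ≠ 0) (t : ℤ) :
    eulerSign m t = squareWave m (2 * eulerQuotient m t) *
      squareWave m (2 * eulerQuotient m (t + m)) * squareWave m (2 * eulerQuotient m (t + 2 * m)) *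
      squareWave m (2 * eulerQuotient m (t + 3 * m)) := by
  simp only [eulerSign, pow_add, neg_one_pow_eulerBit hm]

theorem eulerSign_of_not_isCoprime {m : ℕ} (hm : m ≠ 0) {t : ℤ} (h : ¬IsCoprime t m) :
    eulerSign m t = 1 := by
  have h0 : squareWave m 0 = 1 := squareWave_eq_one le_rfl (by omega)
  have h1 : ¬IsCoprime (t + m) (m : ℤ) := by
    simpa using mt (IsCoprime.add_mul_right_left_iff (z := 1)).1 h
  have h2 : ¬IsCoprime (t + 2 * m) (m : ℤ) := by rwa [IsCoprime.add_mul_right_left_iff]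
  have h3 : ¬IsCoprime (t + 3 * m) (m : ℤ) := by rwa [IsCoprime.add_mul_right_left_iff]
  rw [eulerSign_eq hm, eulerQuotient_eq_zero h, eulerQuotient_eq_zero h1, eulerQuotient_eq_zero h2,
    eulerQuotient_eq_zero h3, mul_zero, h0]
  norm_num

/-- The increment `2 * φ(m) * l * t'` is a multiple of `d`, so it passes through the floor division
by `d` that turns the wave for `m` into the wave for `k`. -/
theorem eulerSign_add_mul {m d k u : ℕ} (hm : m ≠ 0) (hmk : m = d * k)
    (hu : Nat.totient m = d * u) {t t' : ℤ} (h : t * t' ≡ 1 [ZMOD m]) (l : ℤ) :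
    eulerSign m (t + m * l) =
      waveProd k (2 * u * t') (2 * eulerQuotient m t / d + 2 * u * t' * l) := by
  have hd : (d : ℤ) ≠ 0 := by
    have := left_ne_zero_of_mul (hmk ▸ hm)
    exact_mod_cast this
  have key : ∀ r : ℤ, squareWave m (2 * eulerQuotient m (t + m * r)) =
      squareWave k (2 * eulerQuotient m t / d + 2 * u * t' * r) := by
    intro r
    rw [squareWave_two_mul_congr hm (eulerQuotient_add_mul hm h r)]
    conv_lhs => rw [hu]
    conv_lhs => enter [1]; rw [hmk]
    rw [squareWave_mul_left]
    congr 1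
    rw [← Int.add_mul_ediv_right _ _ hd]
    congr 1
    push_cast
    ring
  rw [eulerSign_eq hm, waveProd,
    show t + m * l + m = t + m * (l + 1) by ring,
    show t + m * l + 2 * m = t + m * (l + 2) by ring,
    show t + m * l + 3 * m = t + m * (l + 3) by ring, key, key, key, key]
  ring_nf

/-- As `k` is odd, `2 * u * t'` is a unit modulo `k`. The argument then runs through all residues,
and the offset depending on `Q_m(t)` drops out. -/
theorem sum_eulerSign_of_mul_modEq_one {m d k u : ℕ} (hm : m ≠ 0) (hmk : m = d * k)
    (hodd : Odd k) (hu : Nat.totient m = d * u) (huk : Nat.Coprime u k) {t t' : ℤ}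
    (h : t * t' ≡ 1 [ZMOD m]) :
    ∑ l ∈ Finset.range k, eulerSign m (t + m * l) =
      waveCorr k (((2 * u * t' : ℤ) : ZMod k).val) := by
  have hk : k ≠ 0 := right_ne_zero_of_mul (hmk ▸ hm)
  have : NeZero k := ⟨hk⟩
  have hcop : IsCoprime (2 * u * t') (k : ℤ) := by
    have h2 : IsCoprime (2 : ℤ) k := by
      exact_mod_cast Nat.isCoprime_iff_coprime.2 (Nat.coprime_two_left.2 hodd)
    refine (h2.mul_left (Nat.isCoprime_iff_coprime.2 huk)).mul_left ?_
    have ht' : IsCoprime t' (m : ℤ) :=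
      isCoprime_of_mul_modEq_one (by rwa [mul_comm] : t' * t ≡ 1 [ZMOD m])
    exact ht'.of_isCoprime_of_dvd_right ⟨d, by rw [hmk]; push_cast; ring⟩
  simp only [eulerSign_add_mul hm hmk hu h]
  rw [(waveProd_periodic hk _).sum_range_affine hk _ hcop]
  rw [← sum_waveProd (ZMod.val_lt _)]
  refine Finset.sum_congr rfl fun i _ => ?_
  rw [ZMod.val_intCast, waveProd_emod hk]

/-! ### Averaging over the units modulo `m`. -/

/-- Averaging over translates by `H` replaces a count of the fibres. -/
theorem card_mul_sum_comp {G H : Type*} [Group G] [Group H] [Fintype G] [Fintype H] (f : G →* H)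
    (hf : Function.Surjective f) (g : H → ℝ) :
    (Fintype.card H : ℝ) * ∑ x, g (f x) = Fintype.card G * ∑ y, g y := by
  have h1 : ∀ y : H, ∑ x, g (f x) = ∑ x, g (f x * y) := by
    intro y
    obtain ⟨z, rfl⟩ := hf y
    simpa using (Equiv.sum_comp (Equiv.mulRight z) fun x => g (f x)).symm
  have h2 : ∀ x : G, ∑ y, g (f x * y) = ∑ y, g y := fun x =>
    Equiv.sum_comp (Equiv.mulLeft (f x)) g
  calc (Fintype.card H : ℝ) * ∑ x, g (f x) = ∑ _y : H, ∑ x, g (f x) := by simp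
    _ = ∑ y : H, ∑ x, g (f x * y) := Finset.sum_congr rfl fun y _ => h1 y
    _ = ∑ x, ∑ y, g (f x * y) := Finset.sum_comm
    _ = Fintype.card G * ∑ y, g y := by simp [h2]

theorem sum_coprime_eq_sum_units (m : ℕ) [NeZero m] (g : ℕ → ℝ) :
    ∑ t ∈ (Finset.range m).filter (Nat.Coprime · m), g t =
      ∑ x : (ZMod m)ˣ, g (x : ZMod m).val := by
  symm
  refine Finset.sum_bij (fun x _ => (x : ZMod m).val) ?_ ?_ ?_ ?_
  · intro x _
    simpa [ZMod.val_lt] using ZMod.val_coe_unit_coprime x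
  · intro x _ y _ h
    exact Units.ext (ZMod.val_injective m h)
  · intro t ht
    simp only [Finset.mem_filter, Finset.mem_range] at ht
    exact ⟨ZMod.unitOfCoprime t ht.2, Finset.mem_univ _, by
      rw [ZMod.coe_unitOfCoprime, ZMod.val_cast_of_lt ht.1]⟩
  · intros
    rfl

theorem totient_mul_sum_eulerSign {m d k u : ℕ} (hm : m ≠ 0) (hmk : m = d * k)
    (hodd : Odd k) (hu : Nat.totient m = d * u) (huk : Nat.Coprime u k) :
    (Nat.totient k : ℝ) * ∑ t ∈ (Finset.range m).filter (Nat.Coprime · m),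
        ∑ l ∈ Finset.range k, eulerSign m (t + m * l) =
      Nat.totient m * ∑ b ∈ (Finset.range k).filter (Nat.Coprime · k), waveCorr k b := by
  have hk : k ≠ 0 := right_ne_zero_of_mul (hmk ▸ hm)
  have : NeZero k := ⟨hk⟩
  have : NeZero m := ⟨hm⟩
  have hkm : k ∣ m := ⟨d, by rw [hmk, mul_comm]⟩
  have hv : Nat.Coprime (2 * u) k := (Nat.coprime_two_left.2 hodd).mul_left huk
  rw [sum_coprime_eq_sum_units m (fun t => ∑ l ∈ Finset.range k, eulerSign m (t + m * l)),
    sum_coprime_eq_sum_units k (fun b => waveCorr k b)]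
  have hx : ∀ x : (ZMod m)ˣ,
      ∑ l ∈ Finset.range k, eulerSign m (((x : ZMod m).val : ℕ) + m * l) =
      waveCorr k ((ZMod.unitOfCoprime (2 * u) hv * (ZMod.unitsMap hkm x)⁻¹ :
        (ZMod k)ˣ) : ZMod k).val := by
    intro x
    have h : (((x : ZMod m).val : ℕ) : ℤ) * ((((x⁻¹ : (ZMod m)ˣ) : ZMod m).val : ℕ) : ℤ) ≡ 1
        [ZMOD m] := by
      rw [← ZMod.intCast_eq_intCast_iff]
      simp
    rw [sum_eulerSign_of_mul_modEq_one hm hmk hodd hu huk h]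
    congr 3
    rw [Units.val_mul, ZMod.coe_unitOfCoprime, ← map_inv]
    push_cast
    rw [ZMod.unitsMap_def]
    simp [ZMod.castHom_apply, ZMod.natCast_val]
  simp only [hx]
  rw [← ZMod.card_units_eq_totient k, ← ZMod.card_units_eq_totient m,
    card_mul_sum_comp (ZMod.unitsMap hkm) (ZMod.unitsMap_surjective hkm) (fun y =>
      waveCorr k ((ZMod.unitOfCoprime (2 * u) hv * y⁻¹ : (ZMod k)ˣ) : ZMod k).val)]
  congr 1
  exact ((Equiv.inv _).trans (Equiv.mulLeft (ZMod.unitOfCoprime (2 * u) hv))).sum_comp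
    fun y : (ZMod k)ˣ => waveCorr k (y : ZMod k).val

/-! ### Assembly of the estimate. -/

theorem sum_range_mul_eq (f : ℕ → ℝ) (k m : ℕ) :
    ∑ t ∈ Finset.range (k * m), f t =
      ∑ t ∈ Finset.range m, ∑ l ∈ Finset.range k, f (t + m * l) := by
  induction k with
  | zero => simp
  | succ k ih =>
    simp only [Finset.sum_range_succ, Finset.sum_add_distrib]
    rw [Nat.succ_mul, Finset.sum_range_add, ih]
    congr 1
    exact Finset.sum_congr rfl fun t _ => by rw [add_comm, mul_comm]

theorem abs_sum_eulerSign_sub_le {m k : ℕ} (hm : Odd m) (hkm : k ∣ m)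
    (h : IsPeriodMultiplier m k) :
    |∑ t ∈ Finset.range (k * m), eulerSign m t -
        ((k : ℝ) * m - 2 / 3 * k * Nat.totient m)| ≤
      44 * ((Nat.totient m : ℝ) * (Nat.totient k : ℝ)⁻¹ * (k : ℝ) ^ (3 / 2 : ℝ)) := by
  have hm0 : m ≠ 0 := hm.pos.ne'
  obtain ⟨d, u, hmk, hu, huk⟩ := h.exists_factor hm0 hkm
  have hk0 : k ≠ 0 := right_ne_zero_of_mul (hmk ▸ hm0)
  have hodd : Odd k := hm.of_dvd_nat hkm
  have hphi : (0 : ℝ) < Nat.totient k := by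
    exact_mod_cast Nat.totient_pos.2 (Nat.pos_of_ne_zero hk0)
  have hmain := totient_mul_sum_eulerSign hm0 hmk hodd hu huk
  have hbound := abs_sum_coprime_waveCorr_sub_le hk0
  set S := ∑ t ∈ (Finset.range m).filter (Nat.Coprime · m),
    ∑ l ∈ Finset.range k, eulerSign m (t + m * l)
  set U := ∑ b ∈ (Finset.range k).filter (Nat.Coprime · k), waveCorr k b
  have hcard : (((Finset.range m).filter (Nat.Coprime · m)).card : ℝ) = Nat.totient m := by
    rw [Nat.totient_eq_card_coprime]
    simp only [Nat.coprime_comm]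
  have hnot : ∑ t ∈ (Finset.range m).filter (¬Nat.Coprime · m),
      ∑ l ∈ Finset.range k, eulerSign m (t + m * l) = (m - Nat.totient m) * k := by
    have hc := Finset.card_filter_add_card_filter_not (s := Finset.range m) (Nat.Coprime · m)
    rw [Finset.card_range] at hc
    have hc' : (((Finset.range m).filter (¬Nat.Coprime · m)).card : ℝ) = m - Nat.totient m := by
      rw [← hcard, eq_sub_iff_add_eq']
      exact_mod_cast hc
    rw [← hc', ← nsmul_eq_mul]
    refine Finset.sum_eq_card_nsmul fun t ht => ?_
    have ht' : ¬IsCoprime (t : ℤ) m := by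
      rw [Nat.isCoprime_iff_coprime]
      exact (Finset.mem_filter.1 ht).2
    rw [Finset.sum_congr rfl fun l _ => eulerSign_of_not_isCoprime hm0
      (by rwa [IsCoprime.add_mul_left_left_iff])]
    simp
  have hsum : ∑ t ∈ Finset.range (k * m), eulerSign m t = S + (m - Nat.totient m) * k := by
    rw [sum_range_mul_eq (fun t => eulerSign m t), ← hnot, ← Finset.sum_filter_add_sum_filter_not
      (Finset.range m) (Nat.Coprime · m)]
    push_cast
    rfl
  have hdiff : ∑ t ∈ Finset.range (k * m), eulerSign m t -
      ((k : ℝ) * m - 2 / 3 * k * Nat.totient m) =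
      Nat.totient m * (Nat.totient k : ℝ)⁻¹ * (U - k * Nat.totient k / 3) := by
    have : S = Nat.totient m * (Nat.totient k : ℝ)⁻¹ * U := by
      field_simp
      linear_combination hmain
    rw [hsum, this]
    field_simp
    ring
  have hdiv : (k.divisors.card : ℝ) ≤ 2 * Real.sqrt k := by
    calc (k.divisors.card : ℝ) ≤ ((2 * k.sqrt : ℕ) : ℝ) := by
          exact_mod_cast Nat.card_divisors_le_two_mul_sqrt k
      _ ≤ 2 * Real.sqrt k := by
          push_cast
          gcongr
          exact Real.nat_sqrt_le_real_sqrt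
  have hpow : (k : ℝ) ^ (3 / 2 : ℝ) = k * Real.sqrt k := by
    rw [Real.sqrt_eq_rpow, show (3 / 2 : ℝ) = 1 + 1 / 2 by norm_num,
      Real.rpow_add (by exact_mod_cast Nat.pos_of_ne_zero hk0), Real.rpow_one]
  rw [hdiff, abs_mul, abs_of_nonneg (by positivity : (0 : ℝ) ≤ Nat.totient m *
    (Nat.totient k : ℝ)⁻¹), hpow]
  calc (Nat.totient m : ℝ) * (Nat.totient k : ℝ)⁻¹ * |U - k * Nat.totient k / 3|
      ≤ Nat.totient m * (Nat.totient k : ℝ)⁻¹ * (22 * k * (2 * Real.sqrt k)) := by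
        gcongr
        exact hbound.trans (by gcongr)
    _ = _ := by ring

theorem theorem1 :
    ∃ C : ℝ, ∀ m k : ℕ, 2 ≤ m → Odd m → 3 < k → k ∣ m →
      IsPeriodMultiplier m k →
      |(∑ t ∈ Finset.range (k * m),
            (-1 : ℝ) ^ (eulerBit m (t : ℤ) + eulerBit m ((t : ℤ) + (m : ℤ))
              + eulerBit m ((t : ℤ) + 2 * (m : ℤ)) + eulerBit m ((t : ℤ) + 3 * (m : ℤ))))
          - ((k : ℝ) * (m : ℝ) - 2 / 3 * (k : ℝ) * (Nat.totient m : ℝ))|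
        ≤ C * ((Nat.totient m : ℝ) * (Nat.totient k : ℝ)⁻¹ * (k : ℝ) ^ (3 / 2 : ℝ)
            * Real.log (m : ℝ) ^ 4) := by
  -- The bound already holds without the logarithm; since `m ≥ 3 > e`, the factor `(log m) ^ 4` is
  -- at least one.
  refine ⟨44, fun m k _ hodd hk hkm h => (abs_sum_eulerSign_sub_le hodd hkm h).trans ?_⟩
  have hm : (3 : ℝ) ≤ m := by
    have := Nat.le_of_dvd hodd.pos hkm
    exact_mod_cast (by omega : 3 ≤ m)
  have hlog : 1 ≤ Real.log m := by
    rw [Real.le_log_iff_exp_le (by linarith)]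
    exact Real.exp_one_lt_three.le.trans hm
  refine mul_le_mul_of_nonneg_left ?_ (by norm_num)
  exact le_mul_of_one_le_right (by positivity) (one_le_pow₀ hlog)
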